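/- A multiring is a commutative monoid $(A,\cdot,1)$ with a map $+\colon A\times A\to\wp(A)\setminus\{\emptyset\}$, a map $-\colon A\to A$ and an element $0\in A$ such that for all $a,b,c,d\in A$: if $a\in b+c$ then $c\in -b+a$ and $b\in a+(-c)$; $a\in b+0$ iff $a=b$; if $x\in g+c$ with $g\in a+b$ then $x\in a+h$ for some $h\in b+c$; $a+b=b+a$; $a\cdot 0=0$; if $a\in b+c$ then $ad\in bd+cd$. It is a hyperring if, moreover, every $x\in bd+cd$ is of the form $x=ad$ with $a\in b+c$, and a hyperring is a von Neumann hyperring if for every $a\in A$ there is $b\in A$ with $a=a^2b$. A proper preorder of $A$ is a subset $T\subseteq A$ such that $a^2\in T$ for all $a\in A$, $T\cdot T\subseteq T$, $T+T\subseteq T$ and $-1\notin T$. A von Neumann p-hyperring is a pair $(A,T)$ where $A$ is a von Neumann hyperring and $T$ is a proper preorder of $A$. Let $\mathbf 3=\{1,0,-1\}$ be the multiring with the usual product and opposite and the sum $0+x=x+0=\{x\}$, $1+1=\{1\}$, $(-1)+(-1)=\{-1\}$, $1+(-1)=(-1)+1=\mathbf 3$. Let $\mathrm{sper}_T(A)$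 be the set of multiring morphisms $\sigma\colon A\to\mathbf 3$ (maps preserving $\cdot$, $-$, $0$, $1$ and such that $a\in b+c$ implies $\sigma(a)\in\sigma(b)+\sigma(c)$) with $\sigma(T)\subseteq\{0,1\}$. For $a\in A$ let $\hat a\colon\mathrm{sper}_T(A)\to\mathbf 3$, $\hat a(\sigma)=\sigma(a)$, and let $Q_T(A)=\{\hat a : a\in A\}$, with $0=\hat 0$, $1=\hat 1$, $-\hat a=\widehat{-a}$, $\hat a\cdot\hat b=\widehat{ab}$, and $\hat a\in\hat b+\hat c$ iff there are $a',b',c'\in A$ with $\hat{a'}=\hat a$, $\hat{b'}=\hat b$, $\hat{c'}=\hat c$ and $a'\in b'+c'$. Let $\mathcal L_{multi}=\{\pi,\cdot,-,0,1\}$ be the first-order language of multirings, in which the ternary relation symbol $\pi(a,b,c)$ is interpreted as $a\in b+c$, and let $\mathcal L_{pMulti}=\mathcal L_{multi}\cup\{T\}$ with $T$ a unary relation symbol, interpreted in a pair $(A,T)$ as the preorder. **Theorem.** Let $(A,T)$ and $(B,P)$ be von Neumann p-hyperrings. If $(A,T)\equiv_{\mathcal L_{pMulti}}(B,P)$, then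 $Q_T(A)\equiv_{\mathcal L_{multi}}Q_P(B)$, where $\equiv_{\mathcal L}$ means that the two structures satisfy the same first-order $\mathcal L$-sentences. -/

import Mathlib

universe u v

/-- The operations of a multiring; `madd b c` is the set `b + c`. -/
class MultiOps (A : Type u) extends Mul A, Neg A, Zero A, One A where
  /-- The multivalued sum. -/
  madd : A → A → Set A

open MultiOps (madd)

/-- Multirings. -/
class Multiring (A : Type u) extends CommMonoid A, MultiOps A where
  madd_nonempty : ∀ a b : A, (madd a b).Nonempty
  mem_neg_madd_of_mem : ∀ a b c : A, a ∈ madd b c → c ∈ madd (-b) a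
  mem_madd_neg_of_mem : ∀ a b c : A, a ∈ madd b c → b ∈ madd a (-c)
  mem_madd_zero : ∀ a b : A, a ∈ madd b 0 ↔ a = b
  madd_assoc' : ∀ a b c g x : A, g ∈ madd a b → x ∈ madd g c → ∃ h ∈ madd b c, x ∈ madd a h
  madd_comm' : ∀ a b : A, madd a b = madd b a
  mul_zero' : ∀ a : A, a * 0 = 0
  half_distrib : ∀ a b c d : A, a ∈ madd b c → a * d ∈ madd (b * d) (c * d)

/-- A hyperring is a multiring with the converse of half distributivity. -/
def IsHyperring (A : Type u) [Multiring A] : Prop :=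
  ∀ b c d x : A, x ∈ madd (b * d) (c * d) → ∃ a ∈ madd b c, x = a * d

/-- Von Neumann (regular) hyperrings. -/
structure IsVonNeumannHyperring (A : Type u) [Multiring A] : Prop where
  isHyperring : IsHyperring A
  regular : ∀ a : A, ∃ b : A, a = a ^ 2 * b

/-- Morphisms of multirings. -/
structure MultiringHom (A : Type u) (B : Type v) [Multiring A] [Multiring B] where
  toFun : A → B
  map_madd : ∀ a b c : A, a ∈ madd b c → toFun a ∈ madd (toFun b) (toFun c)
  map_mul : ∀ a b : A, toFun (a * b) = toFun a * toFun b
  map_zero : toFun 0 = 0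
  map_one : toFun 1 = 1
  map_neg : ∀ a : A, toFun (-a) = -toFun a

instance (A : Type u) (B : Type v) [Multiring A] [Multiring B] :
    CoeFun (MultiringHom A B) (fun _ => A → B) := ⟨MultiringHom.toFun⟩

/-- The signal hyperfield `{1, 0, -1}`: usual product, `0 + x = {x}`, `1 + 1 = {1}`,
`(-1) + (-1) = {-1}` and `1 + (-1) = {1, 0, -1}`. -/
instance : MultiOps SignType where
  madd a b := {x | (a = 0 ∧ x = b) ∨ (b = 0 ∧ x = a) ∨ (a = b ∧ x = a) ∨
    (a ≠ 0 ∧ b ≠ 0 ∧ a ≠ b)}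

instance (a b x : SignType) : Decidable (x ∈ madd a b) :=
  inferInstanceAs (Decidable ((a = 0 ∧ x = b) ∨ (b = 0 ∧ x = a) ∨ (a = b ∧ x = a) ∨
    (a ≠ 0 ∧ b ≠ 0 ∧ a ≠ b)))

instance : Multiring SignType where
  mul_assoc := mul_assoc
  one_mul := one_mul
  mul_one := mul_one
  mul_comm := mul_comm
  madd_nonempty := by
    have h : ∀ a b : SignType, ∃ x, x ∈ madd a b := by decide
    exact h
  mem_neg_madd_of_mem := by decide
  mem_madd_neg_of_mem := by decide
  mem_madd_zero := by decide
  madd_assoc' := by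
    have h : ∀ a b c g x : SignType, g ∈ madd a b → x ∈ madd g c →
        ∃ h, h ∈ madd b c ∧ x ∈ madd a h := by decide
    exact h
  madd_comm' := by
    have h : ∀ a b x : SignType, x ∈ madd a b ↔ x ∈ madd b a := by decide
    exact fun a b => Set.ext (h a b)
  mul_zero' := by decide
  half_distrib := by decide

/-- Proper preorders of a multiring. -/
structure IsProperPreorder {A : Type u} [Multiring A] (T : Set A) : Prop where
  sq_mem : ∀ a : A, a ^ 2 ∈ T
  mul_mem : ∀ s ∈ T, ∀ t ∈ T, s * t ∈ T
  madd_subset : ∀ s ∈ T, ∀ t ∈ T, madd s t ⊆ T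
  neg_one_notMem : (-1 : A) ∉ T

/-- A p-multiring: a multiring together with a proper preorder. -/
structure PMultiring where
  carrier : Type u
  [multiring : Multiring carrier]
  T : Set carrier
  isProperPreorder : IsProperPreorder T

instance : CoeSort PMultiring.{u} (Type u) := ⟨PMultiring.carrier⟩

instance (A : PMultiring.{u}) : Multiring A := A.multiring

namespace PMultiring

/-- The orders of `A` (morphisms into the signal hyperfield) that preserve `T`. -/
def SperT (A : PMultiring.{u}) : Type u :=
  {σ : MultiringHom A SignType // ∀ t ∈ A.T, σ t = 0 ∨ σ t = 1}

/-- The map `a ↦ (σ ↦ σ a)`. -/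
def hat (A : PMultiring.{u}) (a : A) : A.SperT → SignType := fun σ => σ.1 a

/-- The real reduced multiring `Q_T(A)`: the set of the functions `hat a`, `a ∈ A`. -/
def Q (A : PMultiring.{u}) : Type u := Set.range A.hat

/-- Product, opposite and constants of `Q_T(A)` are those induced by `A`, that is, the pointwise
ones; `x ∈ y + z` if `x`, `y`, `z` have representatives `a`, `b`, `c` in `A` with `a ∈ b + c`. -/
instance (A : PMultiring.{u}) : MultiOps A.Q where
  mul x y := ⟨fun σ => x.1 σ * y.1 σ, by
    obtain ⟨_, a, rfl⟩ := x
    obtain ⟨_, b, rfl⟩ := y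
    exact ⟨a * b, funext fun σ => σ.1.map_mul a b⟩⟩
  neg x := ⟨fun σ => -x.1 σ, by
    obtain ⟨_, a, rfl⟩ := x
    exact ⟨-a, funext fun σ => σ.1.map_neg a⟩⟩
  zero := ⟨A.hat 0, 0, rfl⟩
  one := ⟨A.hat 1, 1, rfl⟩
  madd y z := {x | ∃ a b c : A, A.hat a = x.1 ∧ A.hat b = y.1 ∧ A.hat c = z.1 ∧ a ∈ madd b c}

end PMultiring

/-- The function symbols `0`, `1`, `-`, `·`. -/
inductive MultiFunctions : ℕ → Type
  | zero : MultiFunctions 0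
  | one : MultiFunctions 0
  | neg : MultiFunctions 1
  | mul : MultiFunctions 2

/-- The ternary relation symbol for the multivalued sum. -/
inductive MultiRelations : ℕ → Type
  | sum : MultiRelations 3

/-- The relation symbols of p-multirings: the sum and a unary relation symbol for the preorder. -/
inductive PMultiRelations : ℕ → Type
  | sum : PMultiRelations 3
  | preorder : PMultiRelations 1

/-- The language of multirings. -/
def multiLang : FirstOrder.Language.{0, 0} := ⟨MultiFunctions, MultiRelations⟩

/-- The language of p-multirings. -/
def pMultiLang : FirstOrder.Language.{0, 0} := ⟨MultiFunctions, PMultiRelations⟩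

/-- The interpretation of the function symbols. -/
def MultiFunctions.interp {A : Type u} [MultiOps A] : {n : ℕ} → MultiFunctions n →
    (Fin n → A) → A
  | _, .zero, _ => 0
  | _, .one, _ => 1
  | _, .neg, x => -x 0
  | _, .mul, x => x 0 * x 1

/-- The interpretation of the sum symbol. -/
def MultiRelations.interp {A : Type u} [MultiOps A] : {n : ℕ} → MultiRelations n →
    (Fin n → A) → Prop
  | _, .sum, x => x 0 ∈ madd (x 1) (x 2)

/-- The interpretation of the relation symbols of p-multirings, given the preorder. -/
def PMultiRelations.interp {A : Type u} [MultiOps A] (T : Set A) : {n : ℕ} →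
    PMultiRelations n → (Fin n → A) → Prop
  | _, .sum, x => x 0 ∈ madd (x 1) (x 2)
  | _, .preorder, x => x 0 ∈ T

instance (A : Type u) [MultiOps A] : multiLang.Structure A where
  funMap f x := MultiFunctions.interp f x
  RelMap r x := MultiRelations.interp r x

instance (A : PMultiring.{u}) : pMultiLang.Structure A where
  funMap f x := MultiFunctions.interp f x
  RelMap r x := PMultiRelations.interp A.T r x

/-! The structure `Q_T(A)` is interpretable in `(A, T)` by formulas that do not depend on `(A, T)`:
its elements are those of `A` modulo `hat a = hat b`, its sum is the image of the sum of `A`, so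
everything reduces to defining `hat a = hat b` without mentioning orders. A function into `{1, 0,
-1}` is determined by where it and its opposite equal `1`, so it suffices to define "`b` is positive
wherever `a` is".

This is a Positivstellensatz. If `a = a²c`, then `e = ac` is idempotent, and an order with `σ a ≥ 0`
has `σ a = 1` as soon as `σ e = 1`. Hence an order with `σ a = 1` and `σ b ≠ 1` is an order
nonnegative on `T`, `a`, `-b` with `σ e = 1`. By Zorn's lemma (`exists_order_of_idempotent`) one
exists unless `-e` lies in the preorder generated by `T`, `a`, `-b`. That preorder is obtained by
adjoining two elements, so membership is witnessed by four elements of `T` and is first-order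
(`posImp_iff`). Sentences about `Q_T(A)` then translate into sentences about `(A, T)`
(`models_translate`). -/

namespace Multiring

variable {A : Type u} [Multiring A]

/-! ### Arithmetic in multirings -/

lemma zero_mem_madd_neg (a : A) : (0 : A) ∈ madd a (-a) := by
  rw [madd_comm']
  exact mem_neg_madd_of_mem a a 0 ((mem_madd_zero a a).2 rfl)

lemma eq_neg_of_zero_mem {a b : A} (h : (0 : A) ∈ madd a b) : b = -a :=
  (mem_madd_zero _ _).1 (mem_neg_madd_of_mem _ _ _ h)

lemma neg_neg' (a : A) : -(-a) = a :=
  (eq_neg_of_zero_mem (by rw [madd_comm']; exact zero_mem_madd_neg a)).symm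

lemma zero_mul' (a : A) : 0 * a = 0 := by rw [mul_comm, mul_zero']

lemma neg_mul' (a b : A) : -a * b = -(a * b) := by
  apply eq_neg_of_zero_mem
  have := half_distrib _ _ _ b (zero_mem_madd_neg a)
  rwa [zero_mul'] at this

lemma mul_neg' (a b : A) : a * -b = -(a * b) := by
  rw [mul_comm, neg_mul', mul_comm]

lemma neg_mul_neg' (a b : A) : -a * -b = a * b := by
  rw [neg_mul', mul_neg', neg_neg']

lemma neg_zero' : (-0 : A) = 0 :=
  (eq_neg_of_zero_mem ((mem_madd_zero (0 : A) 0).2 rfl)).symm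

lemma neg_mem_madd {a b c : A} (h : a ∈ madd b c) : -a ∈ madd (-b) (-c) := by
  have := half_distrib _ _ _ (-1) h
  simpa only [mul_neg', mul_one] using this

lemma mem_madd_comm {a b c : A} (h : a ∈ madd b c) : a ∈ madd c b := by
  rwa [madd_comm']

lemma madd_assoc_left {a b c h x : A} (hh : h ∈ madd b c) (hx : x ∈ madd a h) :
    ∃ g ∈ madd a b, x ∈ madd g c := by
  obtain ⟨g, hg, hxg⟩ := madd_assoc' c b a h x (mem_madd_comm hh) (mem_madd_comm hx)
  exact ⟨g, mem_madd_comm hg, mem_madd_comm hxg⟩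

/-- Rearrangement of a sum of two sums. -/
lemma madd_madd_madd_comm {a b c d g h x : A} (hg : g ∈ madd a b) (hh : h ∈ madd c d)
    (hx : x ∈ madd g h) : ∃ p ∈ madd a c, ∃ q ∈ madd b d, x ∈ madd p q := by
  obtain ⟨k, hk, hxk⟩ := madd_assoc' _ _ _ _ _ hg hx
  obtain ⟨l, hl, hkl⟩ := madd_assoc_left hh hk
  obtain ⟨m, hm, hkm⟩ := madd_assoc' _ _ _ _ _ (mem_madd_comm hl) hkl
  obtain ⟨p, hp, hxp⟩ := madd_assoc_left hkm hxk
  exact ⟨p, hp, m, hm, hxp⟩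

/-! ### Preorders and the adjunction of an element -/

/-- Preorders of a multiring, not necessarily proper. -/
structure IsPreorder (T : Set A) : Prop where
  sq_mem : ∀ a : A, a * a ∈ T
  mul_mem : ∀ {s t}, s ∈ T → t ∈ T → s * t ∈ T
  madd_mem : ∀ {s t x}, s ∈ T → t ∈ T → x ∈ madd s t → x ∈ T

namespace IsPreorder

variable {T : Set A}

lemma one_mem (h : IsPreorder T) : (1 : A) ∈ T := by simpa using h.sq_mem 1

lemma zero_mem (h : IsPreorder T) : (0 : A) ∈ T := by simpa [mul_zero'] using h.sq_mem 0

end IsPreorder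

lemma _root_.IsProperPreorder.isPreorder {T : Set A} (h : IsProperPreorder T) : IsPreorder T where
  sq_mem a := by simpa [pow_two] using h.sq_mem a
  mul_mem hs ht := h.mul_mem _ hs _ ht
  madd_mem hs ht hx := h.madd_subset _ hs _ ht hx

/-- The set `T + aT`. -/
def adjoin (T : Set A) (a : A) : Set A := {x | ∃ t ∈ T, ∃ s ∈ T, x ∈ madd t (a * s)}

lemma subset_adjoin {T : Set A} (hT : IsPreorder T) (a : A) : T ⊆ adjoin T a := fun t ht =>
  ⟨t, ht, 0, hT.zero_mem, by rw [mul_zero']; exact (mem_madd_zero _ _).2 rfl⟩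

lemma mem_adjoin_self {T : Set A} (hT : IsPreorder T) (a : A) : a ∈ adjoin T a :=
  ⟨0, hT.zero_mem, 1, hT.one_mem, by
    rw [mul_one, madd_comm']; exact (mem_madd_zero _ _).2 rfl⟩

/-- Closure under sums is where the hyperring axiom enters: it puts `as + as'` inside `a(s + s')`.
For products, `(t + as)y ⊆ ty + a(sy)`, and multiplying `t' + as'` by `a` swaps the two summands
because `a² ∈ T`. -/
lemma IsPreorder.adjoin (hA : IsHyperring A) {T : Set A} (hT : IsPreorder T) (a : A) :
    IsPreorder (adjoin T a) := by
  have hadd : ∀ {x y z : A}, x ∈ Multiring.adjoin T a → y ∈ Multiring.adjoin T a →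
      z ∈ madd x y → z ∈ Multiring.adjoin T a := by
    rintro x y z ⟨t, ht, s, hs, hx⟩ ⟨t', ht', s', hs', hy⟩ hz
    obtain ⟨p, hp, q, hq, hz⟩ := madd_madd_madd_comm hx hy hz
    rw [mul_comm a s, mul_comm a s'] at hq
    obtain ⟨r, hr, rfl⟩ := hA _ _ _ _ hq
    exact ⟨p, hT.madd_mem ht ht' hp, r, hT.madd_mem hs hs' hr, by rwa [mul_comm a r]⟩
  have hmul : ∀ {t y : A}, t ∈ T → y ∈ Multiring.adjoin T a → t * y ∈ Multiring.adjoin T a := by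
    rintro t y ht ⟨t', ht', s', hs', hy⟩
    refine ⟨t * t', hT.mul_mem ht ht', t * s', hT.mul_mem ht hs', ?_⟩
    have := half_distrib _ _ _ t hy
    rwa [mul_comm y, mul_comm t', mul_assoc, mul_comm s'] at this
  have hmula : ∀ {y : A}, y ∈ Multiring.adjoin T a → a * y ∈ Multiring.adjoin T a := by
    rintro y ⟨t', ht', s', hs', hy⟩
    refine ⟨a * a * s', hT.mul_mem (hT.sq_mem a) hs', t', ht', ?_⟩
    have := mem_madd_comm (half_distrib _ _ _ a hy)
    rwa [mul_comm y, mul_comm t', mul_comm (a * s'), ← mul_assoc] at this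
  refine ⟨fun x => subset_adjoin hT a (hT.sq_mem x), ?_, hadd⟩
  rintro x y ⟨t, ht, s, hs, hx⟩ hy
  have := half_distrib _ _ _ y hx
  rw [mul_assoc] at this
  exact hadd (hmul ht hy) (hmula (hmul hs hy)) this

lemma exists_maximal_preorder {T : Set A} (hT : IsPreorder T) (h1 : (-1 : A) ∉ T) :
    ∃ P, T ⊆ P ∧ IsPreorder P ∧ (-1 : A) ∉ P ∧
      ∀ P', IsPreorder P' → P ⊆ P' → (-1 : A) ∉ P' → P' ⊆ P := by
  obtain ⟨P, hTP, hP⟩ := zorn_subset_nonempty {P : Set A | IsPreorder P ∧ (-1 : A) ∉ P} (by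
    intro c hc hchain ⟨s₀, hs₀⟩
    have key : ∀ {x y : A}, x ∈ ⋃₀ c → y ∈ ⋃₀ c → ∃ s ∈ c, x ∈ s ∧ y ∈ s := by
      rintro x y ⟨s, hs, hx⟩ ⟨t, ht, hy⟩
      rcases hchain.total hs ht with h | h
      · exact ⟨t, ht, h hx, hy⟩
      · exact ⟨s, hs, hx, h hy⟩
    refine ⟨⋃₀ c, ⟨⟨fun a => ⟨s₀, hs₀, (hc hs₀).1.sq_mem a⟩, ?_, ?_⟩, ?_⟩,
      fun s hs => Set.subset_sUnion_of_mem hs⟩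
    · intro x y hx hy
      obtain ⟨s, hs, hx, hy⟩ := key hx hy
      exact ⟨s, hs, (hc hs).1.mul_mem hx hy⟩
    · intro x y z hx hy hz
      obtain ⟨s, hs, hx, hy⟩ := key hx hy
      exact ⟨s, hs, (hc hs).1.madd_mem hx hy hz⟩
    · rintro ⟨s, hs, h⟩
      exact (hc hs).2 h) T ⟨hT, h1⟩
  exact ⟨P, hTP, hP.1.1, hP.1.2, fun P' h h' h'' => hP.2 ⟨h, h''⟩ h'⟩

/-! ### Maximal proper preorders come from orders -/

section Maximal

variable {P : Set A}

/-- This single statement yields both totality of `P` and multiplicativity of signs. By maximality,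
adjoining `a` or `b` produces `-1`, so `-at ∈ 1 + s` and `-bt' ∈ 1 + s'`. Multiplying gives
`(ab)(tt') ∈ 1 + r` with `r ∈ P`, and `-(ab) ∈ P` would then force `-1 ∈ P`. -/
lemma neg_mul_notMem_of_maximal (hA : IsHyperring A) (hP : IsPreorder P) (h1 : (-1 : A) ∉ P)
    (hmax : ∀ P', IsPreorder P' → P ⊆ P' → (-1 : A) ∉ P' → P' ⊆ P) {a b : A}
    (ha : a ∉ P) (hb : b ∉ P) : -(a * b) ∉ P := by
  have key : ∀ {a : A}, a ∉ P → ∃ t ∈ P, ∃ s ∈ P, -(a * t) ∈ madd 1 s := by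
    intro a ha
    have : (-1 : A) ∈ adjoin P a := by
      by_contra h
      exact ha (hmax _ (hP.adjoin hA a) (subset_adjoin hP a) h (mem_adjoin_self hP a))
    obtain ⟨s, hs, t, ht, h⟩ := this
    refine ⟨t, ht, s, hs, ?_⟩
    have h2 := neg_mem_madd (mem_neg_madd_of_mem _ _ _ h)
    rw [neg_neg', neg_neg'] at h2
    exact mem_madd_comm h2
  obtain ⟨t, ht, s, hs, hx⟩ := key ha
  obtain ⟨t', ht', s', hs', hy⟩ := key hb
  intro hab
  have hyP := hP.madd_mem hP.one_mem hs' hy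
  have hxy := half_distrib _ _ _ (-(b * t')) hx
  rw [one_mul, neg_mul_neg'] at hxy
  obtain ⟨r, hr, hxr⟩ := madd_assoc' _ _ _ _ _ hy hxy
  have hrP := hP.madd_mem hs' (hP.mul_mem hs hyP) hr
  have h2 := neg_mem_madd (mem_madd_neg_of_mem _ _ _ hxr)
  rw [neg_neg', ← neg_mul_neg', neg_mul_neg', mul_mul_mul_comm, ← neg_mul'] at h2
  exact h1 (hP.madd_mem (hP.mul_mem hab (hP.mul_mem ht ht')) hrP h2)

open Classical in
/-- The sign of an element with respect to an order `P`. -/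
noncomputable def signOf (P : Set A) (a : A) : SignType :=
  if a ∈ P then if -a ∈ P then 0 else 1 else -1

lemma exists_order_of_maximal (hA : IsHyperring A) (hP : IsPreorder P) (h1 : (-1 : A) ∉ P)
    (hmax : ∀ P', IsPreorder P' → P ⊆ P' → (-1 : A) ∉ P' → P' ⊆ P) :
    ∃ σ : MultiringHom A SignType, ∀ a, a ∈ P ↔ 0 ≤ σ a := by
  have hneg := fun {a b : A} => neg_mul_notMem_of_maximal (a := a) (b := b) hA hP h1 hmax
  have htot : ∀ a, a ∉ P → -a ∈ P := by
    intro a ha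
    by_contra hna
    -- Both `a` and `-a` would lie outside `P`, but `-(a · (-a)) = a²` is in `P`.
    apply hneg ha hna
    rw [mul_neg', neg_neg']
    exact hP.sq_mem a
  have hcase : ∀ a, (a ∈ P ∧ -a ∈ P ∧ signOf P a = 0) ∨ (a ∈ P ∧ -a ∉ P ∧ signOf P a = 1) ∨
      (a ∉ P ∧ -a ∈ P ∧ signOf P a = -1) := by
    intro a
    by_cases ha : a ∈ P
    · by_cases hna : -a ∈ P
      · exact Or.inl ⟨ha, hna, by simp [signOf, ha, hna]⟩
      · exact Or.inr (Or.inl ⟨ha, hna, by simp [signOf, ha, hna]⟩)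
    · exact Or.inr (Or.inr ⟨ha, htot a ha, by simp [signOf, ha]⟩)
  have hzero : ∀ {a}, a ∈ P → -a ∈ P → signOf P a = 0 := by
    intro a h h'; simp [signOf, h, h']
  have hone : ∀ {a}, -a ∉ P → signOf P a = 1 := by
    intro a h
    have : a ∈ P := by by_contra h'; exact h (htot a h')
    simp [signOf, h, this]
  have hmone : ∀ {a}, a ∉ P → signOf P a = -1 := by
    intro a h; simp [signOf, h]
  -- The support `P ∩ -P` absorbs products, since one of `b`, `-b` is in `P`.
  have hmul0 : ∀ {a b}, a ∈ P → -a ∈ P → signOf P (a * b) = 0 := by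
    intro a b ha hna
    by_cases hb : b ∈ P
    · exact hzero (hP.mul_mem ha hb) (by rw [← neg_mul']; exact hP.mul_mem hna hb)
    · have hb := htot b hb
      refine hzero ?_ (by rw [← mul_neg']; exact hP.mul_mem ha hb)
      rw [← neg_mul_neg']; exact hP.mul_mem hna hb
  have hsub : ∀ {a b c : A}, a ∈ madd b c → a ∈ P → -b ∈ P → c ∈ P := fun h ha hb =>
    hP.madd_mem hb ha (mem_neg_madd_of_mem _ _ _ h)
  have hsub' : ∀ {a b c : A}, a ∈ madd b c → -a ∈ P → b ∈ P → -c ∈ P := fun h ha hb =>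
    hsub (neg_mem_madd h) ha (by rwa [neg_neg'])
  -- Adding an element of the support does not change the sign.
  have hadd0 : ∀ {a b c : A}, a ∈ madd b c → b ∈ P → -b ∈ P → signOf P a = signOf P c := by
    intro a b c h hb hnb
    have e1 : a ∈ P ↔ c ∈ P := ⟨fun ha => hsub h ha hnb, fun hc => hP.madd_mem hb hc h⟩
    have e2 : -a ∈ P ↔ -c ∈ P :=
      ⟨fun ha => hsub' h ha hb, fun hc => hP.madd_mem hnb hc (neg_mem_madd h)⟩
    classical
    unfold signOf
    exact if_congr e1 (if_congr e2 rfl rfl) rfl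
  refine ⟨⟨signOf P, ?_, ?_, ?_, ?_, ?_⟩, ?_⟩
  · intro a b c h
    show (signOf P b = 0 ∧ signOf P a = signOf P c) ∨ (signOf P c = 0 ∧ signOf P a = signOf P b) ∨
      (signOf P b = signOf P c ∧ signOf P a = signOf P b) ∨
      (signOf P b ≠ 0 ∧ signOf P c ≠ 0 ∧ signOf P b ≠ signOf P c)
    rcases hcase b with ⟨hb, hnb, eb⟩ | ⟨hb, hnb, eb⟩ | ⟨hb, hnb, eb⟩
    · exact Or.inl ⟨eb, hadd0 h hb hnb⟩
    all_goals
      rcases hcase c with ⟨hc, hnc, ec⟩ | ⟨hc, hnc, ec⟩ | ⟨hc, hnc, ec⟩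
      · exact Or.inr (Or.inl ⟨ec, hadd0 (mem_madd_comm h) hc hnc⟩)
    · refine Or.inr (Or.inr (Or.inl ⟨by rw [eb, ec], ?_⟩))
      rw [eb]
      exact hone fun ha => hnc (hsub' h ha hb)
    · refine Or.inr (Or.inr (Or.inr ?_))
      rw [eb, ec]; decide
    · refine Or.inr (Or.inr (Or.inr ?_))
      rw [eb, ec]; decide
    · refine Or.inr (Or.inr (Or.inl ⟨by rw [eb, ec], ?_⟩))
      rw [eb]
      exact hmone fun ha => hc (hsub h ha hnb)
  · intro a b
    rcases hcase a with ⟨ha, hna, ea⟩ | ⟨ha, hna, ea⟩ | ⟨ha, hna, ea⟩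
    · rw [ea, hmul0 ha hna]; exact (zero_mul _).symm
    all_goals
      rcases hcase b with ⟨hb, hnb, eb⟩ | ⟨hb, hnb, eb⟩ | ⟨hb, hnb, eb⟩
      · rw [mul_comm, hmul0 hb hnb, eb]; exact (mul_zero _).symm
    · have := hneg hna hnb
      rw [neg_mul_neg'] at this
      rw [hone this, ea, eb]; rfl
    · have := hneg hna hb
      rw [neg_mul', neg_neg'] at this
      rw [hmone this, ea, eb]; rfl
    · have := hneg ha hnb
      rw [mul_neg', neg_neg'] at this
      rw [hmone this, ea, eb]; rfl
    · rw [hone (hneg ha hb), ea, eb]; rfl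
  · exact hzero hP.zero_mem (by rw [neg_zero']; exact hP.zero_mem)
  · exact hone h1
  · intro a
    rcases hcase a with ⟨ha, hna, ea⟩ | ⟨ha, hna, ea⟩ | ⟨ha, hna, ea⟩
    · rw [ea, hzero hna (by rwa [neg_neg'])]; rfl
    · rw [ea, hmone hna]
    · rw [ea, hone (by rwa [neg_neg'])]; rfl
  · intro a
    change a ∈ P ↔ 0 ≤ signOf P a
    rcases hcase a with ⟨ha, hna, ea⟩ | ⟨ha, hna, ea⟩ | ⟨ha, hna, ea⟩ <;> rw [ea] <;>
      simp [ha]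

end Maximal

/-! ### Orders positive at an idempotent -/

lemma one_of_zero_mem_one_madd_neg {x : SignType} (h : (0 : SignType) ∈ madd 1 (-x)) :
    x = 1 := by
  have key : ∀ x : SignType, 0 ∈ MultiOps.madd 1 (-x) → x = 1 := by decide
  exact key x h

/-- If `e` is idempotent and `-e ∉ S`, some order that is nonnegative on `S` maps `e` to `1`. -/
lemma exists_order_of_idempotent (hA : IsHyperring A) {S : Set A} (hS : IsPreorder S) {e : A}
    (he : e * e = e) (hneg : -e ∉ S) :
    ∃ σ : MultiringHom A SignType, (∀ s ∈ S, 0 ≤ σ s) ∧ σ e = 1 := by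
  have heS : e ∈ S := he ▸ hS.sq_mem e
  -- This preorder contains `S`, and it is proper exactly because `-e ∉ S`.
  have hT : IsPreorder {x | x * e ∈ S} := by
    refine ⟨fun a => hS.mul_mem (hS.sq_mem a) heS, ?_, ?_⟩
    · intro s t hs ht
      have := hS.mul_mem hs ht
      rwa [mul_mul_mul_comm, he] at this
    · intro s t x hs ht hx
      exact hS.madd_mem hs ht (half_distrib _ _ _ e hx)
  obtain ⟨P, hTP, hP, h1, hmax⟩ := exists_maximal_preorder hT
    (by simpa only [Set.mem_ofPred_eq, neg_mul', one_mul] using hneg)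
  obtain ⟨σ, hσ⟩ := exists_order_of_maximal hA hP h1 hmax
  refine ⟨σ, fun s hs => (hσ s).1 (hTP (hS.mul_mem hs heS)), ?_⟩
  -- A complement of `e`: some `f ∈ 1 - e` with `fe = 0`. Both `f` and `-f` lie in the enlarged
  -- preorder, so `σ f = 0`, and `0 ∈ 1 - σ e` forces `σ e = 1`.
  obtain ⟨f, hf, hfe⟩ := hA 1 (-e) e 0 (by
    rw [one_mul, neg_mul', he]; exact zero_mem_madd_neg e)
  have hf0 : 0 ≤ σ f := (hσ f).1 (hTP (by rw [Set.mem_ofPred_eq, ← hfe]; exact hS.zero_mem))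
  have hf1 : 0 ≤ σ (-f) := (hσ (-f)).1 (hTP (by
    rw [Set.mem_ofPred_eq, neg_mul', ← hfe, neg_zero']; exact hS.zero_mem))
  rw [σ.map_neg] at hf1
  have hfz : σ f = 0 := by
    revert hf0 hf1
    generalize σ f = x
    revert x; decide
  have := σ.map_madd _ _ _ hf
  rw [hfz, σ.map_one, σ.map_neg] at this
  exact one_of_zero_mem_one_madd_neg this

lemma sign_nonneg_of_mem_madd {x y z w : SignType} (hy : 0 ≤ y) (hz : 0 ≤ z) (hw : 0 ≤ w)
    (h : x ∈ madd y (z * w)) : 0 ≤ x := by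
  have key : ∀ x y z w : SignType, 0 ≤ y → 0 ≤ z → 0 ≤ w →
      x ∈ MultiOps.madd y (z * w) → 0 ≤ x := by
    decide
  exact key x y z w hy hz hw h

lemma nonneg_of_mem_adjoin (σ : MultiringHom A SignType) {T : Set A} (hσ : ∀ t ∈ T, 0 ≤ σ t)
    {a : A} (ha : 0 ≤ σ a) : ∀ x ∈ adjoin T a, 0 ≤ σ x := by
  rintro x ⟨t, ht, s, hs, hx⟩
  have := σ.map_madd _ _ _ hx
  rw [σ.map_mul] at this
  exact sign_nonneg_of_mem_madd (hσ t ht) ha (hσ s hs) this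

end Multiring

/-! ### Definability of equality in `Q_T(A)` -/

namespace PMultiring

open Multiring

variable (A : PMultiring.{u})

/-- The first-order condition stating that `b` is positive wherever `a` is. -/
def PosImp (a b : A) : Prop :=
  ∃ c, a = a * a * c ∧ -(a * c) ∈ adjoin (adjoin A.T a) (-b)

variable {A}

/-- If `σ a = 1`, then `σ c = 1`, so `-(ac)` has sign `-1`; yet `σ b ≠ 1` would make `σ` nonnegative
on the preorder containing it. Conversely, if `-(ac)` is outside that preorder, the order given by
the idempotent `ac` has `σ a = 1` and `σ (-b) ≥ 0`. -/
lemma posImp_iff (hA : IsVonNeumannHyperring A) (a b : A) :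
    A.PosImp a b ↔ ∀ σ : A.SperT, A.hat a σ = 1 → A.hat b σ = 1 := by
  have hsgn : ∀ x : SignType, (x = 0 ∨ x = 1) ↔ 0 ≤ x := by decide
  constructor
  · rintro ⟨c, hc, hmem⟩ ⟨σ, hσ⟩ ha
    change σ a = 1 at ha
    change σ b = 1
    by_contra hb
    have hb' : 0 ≤ σ (-b) := by
      rw [σ.map_neg]
      revert hb
      generalize σ b = x
      revert x; decide
    have h := nonneg_of_mem_adjoin σ (nonneg_of_mem_adjoin σ (fun t ht => (hsgn _).1 (hσ t ht))
      (a := a) (by rw [ha]; decide)) hb' _ hmem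
    have hc1 := congrArg σ.toFun hc
    rw [σ.map_mul, σ.map_mul, ha] at hc1
    rw [σ.map_neg, σ.map_mul, ha] at h
    revert h
    revert hc1
    change (1 : SignType) = 1 * 1 * σ c → 0 ≤ -(1 * σ c) → False
    generalize σ c = x
    revert x; decide
  · intro h
    obtain ⟨c, hc⟩ := hA.regular a
    rw [pow_two] at hc
    refine ⟨c, hc, ?_⟩
    by_contra hmem
    have hT := A.isProperPreorder.isPreorder
    have hTa := hT.adjoin hA.isHyperring a
    have he : a * c * (a * c) = a * c := by
      rw [mul_mul_mul_comm, ← mul_assoc, ← hc]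
    obtain ⟨σ, hσ, hσe⟩ := exists_order_of_idempotent hA.isHyperring
      (hTa.adjoin hA.isHyperring (-b)) he hmem
    have ha : 0 ≤ σ a := hσ _ (subset_adjoin hTa _ (mem_adjoin_self hT a))
    have hb : 0 ≤ σ (-b) := hσ _ (mem_adjoin_self hTa (-b))
    have hb1 : σ b = 1 := h ⟨σ, fun t ht => (hsgn _).2
      (hσ _ (subset_adjoin hTa _ (subset_adjoin hT _ ht)))⟩ (by
        change σ a = 1
        rw [σ.map_mul] at hσe
        revert ha hσe
        generalize σ a = x
        generalize σ c = y
        revert x y; decide)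
    rw [σ.map_neg, hb1] at hb
    revert hb
    decide

lemma hat_eq_iff (hA : IsVonNeumannHyperring A) (a b : A) :
    A.hat a = A.hat b ↔
      (A.PosImp a b ∧ A.PosImp b a) ∧ A.PosImp (-a) (-b) ∧ A.PosImp (-b) (-a) := by
  simp only [posImp_iff hA, funext_iff, ← forall_and]
  refine forall_congr' fun σ => ?_
  have h : ∀ a : A, A.hat (-a) σ = -A.hat a σ := fun a => σ.1.map_neg a
  rw [h, h]
  generalize A.hat a σ = x
  generalize A.hat b σ = y
  revert x y; decide

/-- The quotient map onto `Q_T(A)`. -/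
def toQ (a : A) : A.Q := ⟨A.hat a, a, rfl⟩

lemma toQ_surjective : Function.Surjective (toQ (A := A)) := by
  rintro ⟨_, a, rfl⟩
  exact ⟨a, rfl⟩

lemma toQ_eq_iff (a b : A) : toQ a = toQ b ↔ A.hat a = A.hat b := Subtype.ext_iff

/-- Only function symbols commute with `toQ` in this way: a sum relation in `Q_T(A)` may need other
representatives, hence the quantifiers in `sumQFormula`. -/
lemma toQ_funMap {n : ℕ} (f : MultiFunctions n) (x : Fin n → A) :
    toQ (f.interp x) = f.interp (toQ ∘ x) := by
  cases f with
  | zero => rfl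
  | one => rfl
  | neg => exact Subtype.ext (funext fun σ => σ.1.map_neg _)
  | mul => exact Subtype.ext (funext fun σ => σ.1.map_mul _ _)

end PMultiring

/-! ### Defining formulas in the language of p-multirings -/

open FirstOrder Language

namespace pMultiLang

variable {α : Type}

/-- The product of two terms. -/
def mulTerm (s t : pMultiLang.Term α) : pMultiLang.Term α :=
  Functions.apply₂ (L := pMultiLang) MultiFunctions.mul s t

/-- The opposite of a term. -/
def negTerm (s : pMultiLang.Term α) : pMultiLang.Term α :=
  Functions.apply₁ (L := pMultiLang) MultiFunctions.neg s

/-- The formula `r ∈ s + t`. -/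
def sumFormula {n : ℕ} (r s t : pMultiLang.Term (α ⊕ Fin n)) : pMultiLang.BoundedFormula α n :=
  BoundedFormula.rel (L := pMultiLang) PMultiRelations.sum ![r, s, t]

/-- The formula `t ∈ T`. -/
def memFormula {n : ℕ} (t : pMultiLang.Term (α ⊕ Fin n)) : pMultiLang.BoundedFormula α n :=
  BoundedFormula.rel (L := pMultiLang) PMultiRelations.preorder ![t]

variable {A : PMultiring.{u}}

@[simp] lemma realize_mulTerm (s t : pMultiLang.Term α) (v : α → A) :
    (mulTerm s t).realize v = s.realize v * t.realize v :=
  rfl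

@[simp] lemma realize_negTerm (s : pMultiLang.Term α) (v : α → A) :
    (negTerm s).realize v = -s.realize v :=
  rfl

@[simp] lemma realize_sumFormula {n : ℕ} (r s t : pMultiLang.Term (α ⊕ Fin n)) (v : α → A)
    (w : Fin n → A) : (sumFormula r s t).Realize v w ↔
      r.realize (Sum.elim v w) ∈ madd (s.realize (Sum.elim v w)) (t.realize (Sum.elim v w)) :=
  Iff.rfl

@[simp] lemma realize_memFormula {n : ℕ} (t : pMultiLang.Term (α ⊕ Fin n)) (v : α → A)
    (w : Fin n → A) : (memFormula t).Realize v w ↔ t.realize (Sum.elim v w) ∈ A.T :=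
  Iff.rfl

/-- The formula expressing `PMultiring.PosImp`. The bound variables are the inverse `c`, the four
elements `t`, `s`, `t'`, `s'` of the preorder, and the sums `u ∈ t + as` and `v ∈ t' + as'`. -/
def posImpFormula : pMultiLang.Formula (Fin 2) :=
  let a : pMultiLang.Term (Fin 2 ⊕ Fin 7) := Term.var (Sum.inl 0)
  let b : pMultiLang.Term (Fin 2 ⊕ Fin 7) := Term.var (Sum.inl 1)
  let x : Fin 7 → pMultiLang.Term (Fin 2 ⊕ Fin 7) := fun i => Term.var (Sum.inr i)
  BoundedFormula.exs (n := 7)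
    ((Term.bdEqual a (mulTerm (mulTerm a a) (x 0))) ⊓
      ((memFormula (x 1) ⊓ memFormula (x 2)) ⊓ (memFormula (x 3) ⊓ memFormula (x 4))) ⊓
      (sumFormula (x 5) (x 1) (mulTerm a (x 2)) ⊓ sumFormula (x 6) (x 3) (mulTerm a (x 4))) ⊓
      sumFormula (negTerm (mulTerm a (x 0))) (x 5) (mulTerm (negTerm b) (x 6)))

lemma realize_posImpFormula (v : Fin 2 → A) :
    posImpFormula.Realize v ↔ A.PosImp (v 0) (v 1) := by
  refine BoundedFormula.realize_exs.trans ?_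
  simp only [BoundedFormula.realize_inf, BoundedFormula.realize_bdEqual, realize_mulTerm, realize_negTerm,
    realize_sumFormula, realize_memFormula, Term.realize_var, Sum.elim_inl, Sum.elim_inr]
  constructor
  · rintro ⟨x, ⟨⟨h, ⟨h1, h2⟩, h3, h4⟩, h5, h6⟩, h7⟩
    exact ⟨x 0, h, x 5, ⟨x 1, h1, x 2, h2, h5⟩, x 6, ⟨x 3, h3, x 4, h4, h6⟩, h7⟩
  · rintro ⟨c, h, p, ⟨t, h1, s, h2, h5⟩, q, ⟨t', h3, s', h4, h6⟩, h7⟩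
    exact ⟨![c, t, s, t', s', p, q], ⟨⟨h, ⟨h1, h2⟩, h3, h4⟩, h5, h6⟩, h7⟩

/-- The formula expressing that two terms have the same image in `Q_T(A)`. -/
def hatEqFormula (s t : pMultiLang.Term α) : pMultiLang.Formula α :=
  (posImpFormula.subst ![s, t] ⊓ posImpFormula.subst ![t, s]) ⊓
    (posImpFormula.subst ![negTerm s, negTerm t] ⊓ posImpFormula.subst ![negTerm t, negTerm s])

lemma realize_subst_posImpFormula (s t : pMultiLang.Term α) (v : α → A) :
    (posImpFormula.subst ![s, t]).Realize v default ↔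
      A.PosImp (s.realize v) (t.realize v) := by
  rw [BoundedFormula.realize_subst]
  exact realize_posImpFormula _

lemma realize_hatEqFormula (hA : IsVonNeumannHyperring A) (s t : pMultiLang.Term α) (v : α → A) :
    (hatEqFormula s t).Realize v ↔
      PMultiring.toQ (s.realize v) = PMultiring.toQ (t.realize v) := by
  rw [PMultiring.toQ_eq_iff, PMultiring.hat_eq_iff hA]
  simp only [hatEqFormula, Formula.Realize, BoundedFormula.realize_inf,
    realize_subst_posImpFormula, realize_negTerm]

/-- A formula whose free variables are indexed by `α ⊕ Fin n` as a bounded formula. -/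
def toBounded {n : ℕ} (φ : pMultiLang.Formula (α ⊕ Fin n)) : pMultiLang.BoundedFormula α n :=
  BoundedFormula.relabel (n := n) (k := 0) id φ

lemma realize_toBounded {n : ℕ} (φ : pMultiLang.Formula (α ⊕ Fin n)) (v : α → A) (w : Fin n → A) :
    (toBounded φ).Realize v w ↔ φ.Realize (Sum.elim v w) := by
  rw [toBounded, BoundedFormula.realize_relabel, Formula.Realize]
  apply iff_of_eq
  congr 1
  exact Subsingleton.elim _ _

/-- The formula expressing `r ∈ s + t` in `Q_T(A)`. -/
def sumQFormula : pMultiLang.Formula (Fin 3) :=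
  BoundedFormula.exs (n := 3)
    (((toBounded (hatEqFormula (Term.var (Sum.inr 0)) (Term.var (Sum.inl 0))) ⊓
        toBounded (hatEqFormula (Term.var (Sum.inr 1)) (Term.var (Sum.inl 1)))) ⊓
      toBounded (hatEqFormula (Term.var (Sum.inr 2)) (Term.var (Sum.inl 2)))) ⊓
      sumFormula (Term.var (Sum.inr 0)) (Term.var (Sum.inr 1)) (Term.var (Sum.inr 2)))

lemma realize_sumQFormula (hA : IsVonNeumannHyperring A) (v : Fin 3 → A) :
    sumQFormula.Realize v ↔
      PMultiring.toQ (v 0) ∈ madd (PMultiring.toQ (v 1)) (PMultiring.toQ (v 2)) := by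
  have key : ∀ (i : Fin 3) (w : Fin 3 → A), BoundedFormula.Realize
      (toBounded (hatEqFormula (Term.var (Sum.inr i)) (Term.var (Sum.inl i)))) v w ↔
      A.hat (w i) = A.hat (v i) := by
    intro i w
    rw [← PMultiring.toQ_eq_iff]
    exact (realize_toBounded _ v w).trans (realize_hatEqFormula hA _ _ _)
  refine BoundedFormula.realize_exs.trans ?_
  simp only [BoundedFormula.realize_inf, key, realize_sumFormula, Term.realize_var, Sum.elim_inr]
  constructor
  · rintro ⟨w, ⟨⟨h0, h1⟩, h2⟩, h⟩
    exact ⟨w 0, w 1, w 2, h0, h1, h2, h⟩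
  · rintro ⟨a, b, c, h0, h1, h2, h⟩
    exact ⟨![a, b, c], ⟨⟨h0, h1⟩, h2⟩, h⟩

end pMultiLang

/-! ### Translation of sentences about `Q_T(A)` -/

namespace multiLang

open pMultiLang

variable {α : Type}

/-- Terms of multirings as terms of p-multirings. -/
def translateTerm : multiLang.Term α → pMultiLang.Term α
  | .var x => .var x
  | .func f ts => Term.func (L := pMultiLang) f fun i => translateTerm (ts i)

/-- The translation of a relation symbol. -/
def translateRel {n : ℕ} : {l : ℕ} → MultiRelations l → (Fin l → pMultiLang.Term (α ⊕ Fin n)) →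
    pMultiLang.BoundedFormula α n
  | _, .sum, ts => toBounded (sumQFormula.subst ts)

/-- The translation of a formula about `Q_T(A)` into a formula about `(A, T)`. -/
def translate : {n : ℕ} → multiLang.BoundedFormula α n → pMultiLang.BoundedFormula α n
  | _, .falsum => .falsum
  | _, .equal s t => toBounded (hatEqFormula (translateTerm s) (translateTerm t))
  | _, .rel R ts => translateRel R fun i => translateTerm (ts i)
  | _, .imp φ ψ => .imp (translate φ) (translate ψ)
  | _, .all φ => .all (translate φ)

variable {A : PMultiring.{u}}

lemma toQ_realize_translateTerm (t : multiLang.Term α) (v : α → A) :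
    PMultiring.toQ ((translateTerm t).realize v) = t.realize (PMultiring.toQ ∘ v) := by
  induction t with
  | var x => rfl
  | func f ts ih =>
    exact (PMultiring.toQ_funMap f _).trans (congrArg (MultiFunctions.interp f) (funext ih))

lemma realize_translate (hA : IsVonNeumannHyperring A) {n : ℕ} (φ : multiLang.BoundedFormula α n)
    (v : α → A) (w : Fin n → A) : (translate φ).Realize v w ↔
      φ.Realize (PMultiring.toQ ∘ v) (PMultiring.toQ ∘ w) := by
  induction φ with
  | falsum => rfl
  | equal s t =>
    refine (realize_toBounded _ v w).trans ((realize_hatEqFormula hA _ _ _).trans ?_)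
    rw [toQ_realize_translateTerm, toQ_realize_translateTerm, Sum.comp_elim]
    rfl
  | rel R ts =>
    cases R
    refine (realize_toBounded _ v w).trans (Iff.trans (BoundedFormula.realize_subst)
      ((realize_sumQFormula hA _).trans ?_))
    rw [toQ_realize_translateTerm, toQ_realize_translateTerm, toQ_realize_translateTerm,
      Sum.comp_elim]
    rfl
  | imp φ ψ ihφ ihψ => exact imp_congr (ihφ w) (ihψ w)
  | all φ ih =>
    change (∀ a : A, _) ↔ ∀ q : A.Q, _
    -- Quantifiers need no relativization, since every element of `Q_T(A)` has a representative in
    -- `A`.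
    rw [PMultiring.toQ_surjective.forall]
    refine forall_congr' fun a => (ih (Fin.snoc w a)).trans ?_
    rw [Fin.comp_snoc]

lemma models_translate (hA : IsVonNeumannHyperring A) (φ : multiLang.Sentence) :
    A ⊨ (translate φ : pMultiLang.Sentence) ↔ A.Q ⊨ φ := by
  refine (realize_translate hA φ default default).trans (iff_of_eq ?_)
  unfold Sentence.Realize Formula.Realize
  -- The two sides differ only in assignments with empty domain.
  congr 1 <;> exact Subsingleton.elim _ _

end multiLang

/-- `Q_T(A)` preserves elementary equivalence of von Neumann p-hyperrings. -/
theorem mainTheorem7 (A : PMultiring.{u}) (B : PMultiring.{v})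
    (hA : IsVonNeumannHyperring A) (hB : IsVonNeumannHyperring B)
    (h : pMultiLang.ElementarilyEquivalent A B) :
    multiLang.ElementarilyEquivalent A.Q B.Q := by
  rw [elementarilyEquivalent_iff] at h ⊢
  intro φ
  rw [← multiLang.models_translate hA, ← multiLang.models_translate hB]
  exact h _
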